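/- Consider a slotted-time network with $K\ge 1$ sensors, $N\ge 1$ users, transmission budget $M\le K$, battery capacities $B_k\in\mathbb{N}$, an age cap $\Delta^{\max}\ge 1$, energy arrival probabilities $\lambda_k\in[0,1]$ and request probabilities $p_{k,n}\in[0,1]$. The finite state space is $\mathcal S=\prod_{k=1}^K \{0,\dots,N\}\times\{0,\dots,B_k\}\times\{1,\dots,\Delta^{\max}\}$, with $\mathbf s=(s_k)_k$ and $s_k=(r_k,b_k,\Delta_k)$ (number of requests, battery level, age of information), and the action space is $\mathcal A=\{\mathbf a\in\{0,1\}^K:\sum_k a_k\le M\}$. Put $d_k=a_k\mathbf 1_{\{b_k\ge1\}}$. Under action $\mathbf a$ in state $\mathbf s$ the sensors evolve independently: the next $r_k'$ is a sum of independent Bernoulli($p_{k,n}$) variables, $n=1,\dots,N$; $b_k'=\min\{b_k+e_k-d_k,B_k\}$ with $e_k$ an independent Bernoulli($\lambda_k$) variable; and $\Delta_k'=\min\{(1-d_k)\Delta_k+1,\Delta^{\max}\}$. Let $\Pr(\mathbf s'|\mathbf s,\mathbf a)$ be the resulting transition probabilities, $c_k(s_k,a_k)=r_k\min\{(1-d_k)\Delta_k+1,\Delta^{\max}\}$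 and $c(\mathbf s,\mathbf a)=\frac1{NK}\sum_{k=1}^K c_k(s_k,a_k)$. A policy $\pi$ assigns to each state $\mathbf s$ a probability distribution $\pi(\cdot|\mathbf s)$ on $\mathcal A$; it is deterministic if in each state $\mathbf s$ it takes one action $\pi(\mathbf s)$ with probability $1$. Its average cost (average on-demand AoI) from the initial state $\mathbf s(0)$ is $$\bar C_\pi=\lim_{T\to\infty}\frac1{NKT}\sum_{t=1}^T\sum_{k=1}^K\mathbb E_\pi[c_k(s_k(t),a_k(t))\mid \mathbf s(0)].$$ Then this limit exists for every policy and every initial state, and the minimum average cost $\bar C^\star=\min_\pi\bar C_\pi$ is attained and does not depend on the initial state $\mathbf s(0)$. It satisfies the Bellman equation: there exists $h:\mathcal S\to\mathbb R$ such that $$\bar C^\star+h(\mathbf s)=\min_{\mathbf a\in\mathcal A}\Big[c(\mathbf s,\mathbf a)+\sum_{\mathbf s'\in\mathcal S}\Pr(\mathbf s'|\mathbf s,\mathbf a)h(\mathbf s')\Big],\qquad \mathbf s\in\mathcal S.$$ Further, for every such $h$, every deterministic policy $\pi^\star$ with $$\pi^\star(\mathbf s)\in\operatorname*{arg\,min}_{\mathbf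 a\in\mathcal A}\Big[c(\mathbf s,\mathbf a)+\sum_{\mathbf s'\in\mathcal S}\Pr(\mathbf s'|\mathbf s,\mathbf a)h(\mathbf s')\Big],\qquad \mathbf s\in\mathcal S,$$ is optimal: its average cost equals $\bar C^\star$ from every initial state. -/

import Mathlib

open Filter Topology

noncomputable section

/-- Parameters of the request-based status updating network: `K` energy harvesting sensors, `N`
users, transmission budget `M`, battery capacities `B k`, AoI cap `Dmax`, energy arrival
probabilities `lam k`, and request probabilities `p k n`. -/
structure Network where
  K : ℕ
  N : ℕ
  M : ℕ
  B : Fin K → ℕ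
  Dmax : ℕ
  lam : Fin K → ℝ
  p : Fin K → Fin N → ℝ
  K_pos : 1 ≤ K
  N_pos : 1 ≤ N
  M_le : M ≤ K
  Dmax_pos : 1 ≤ Dmax
  lam_nonneg : ∀ k, 0 ≤ lam k
  lam_le_one : ∀ k, lam k ≤ 1
  p_nonneg : ∀ k n, 0 ≤ p k n
  p_le_one : ∀ k n, p k n ≤ 1

namespace Network

/-- Per-sensor states `(r, b, Δ)`: `r ∈ {0,…,N}` requests, battery level `b ∈ {0,…,B k}`,
age of information `Δ ∈ {1,…,Dmax}`. -/
abbrev SensorState (P : Network) (k : Fin P.K) : Type :=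
  Fin (P.N + 1) × Fin (P.B k + 1) × (Finset.Icc 1 P.Dmax : Finset ℕ)

/-- The state space: one per-sensor state for each sensor. -/
abbrev State (P : Network) : Type := ∀ k : Fin P.K, P.SensorState k

/-- The action space: vectors in `{0,1}^K` with at most `M` commands. -/
abbrev Action (P : Network) : Type :=
  {a : Fin P.K → Fin 2 // ∑ k, (a k : ℕ) ≤ P.M}

variable (P : Network)

/-- The action `d = a · 1{b ≥ 1}` of a sensor with battery level `b` under command `a`. -/
def sends (b a : ℕ) : ℕ := a * (if 1 ≤ b then 1 else 0)

/-- The next age of information, `min ((1 - d) Δ + 1) Dmax`. -/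
def nextAge (b age a : ℕ) : ℕ := min ((1 - sends b a) * age + 1) P.Dmax

/-- The next battery level, `min (b + e - d) (B k)`, when `e` units of energy arrive. -/
def nextBattery (k : Fin P.K) (b e a : ℕ) : ℕ := min (b + e - sends b a) (P.B k)

/-- The per-sensor cost `r · Δ'`, with `Δ'` the next age of information. -/
def sensorCost (k : Fin P.K) (s : P.SensorState k) (a : Fin 2) : ℝ :=
  (s.1 : ℕ) * (P.nextAge s.2.1 s.2.2 a : ℝ)

/-- The cost of taking action `a` in state `s`. -/
def cost (s : P.State) (a : P.Action) : ℝ :=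
  1 / ((P.N : ℝ) * P.K) * ∑ k, P.sensorCost k (s k) (a.1 k)

/-- The probability that exactly `r` of the `N` users request the status from sensor `k`
(a sum of independent Bernoulli variables with parameters `p k n`). -/
def requestProb (k : Fin P.K) (r : ℕ) : ℝ :=
  ∑ A ∈ Finset.powersetCard r (Finset.univ : Finset (Fin P.N)),
    (∏ n ∈ A, P.p k n) * ∏ n ∈ Aᶜ, (1 - P.p k n)

/-- The probability of moving from battery level `b` to `b'` under command `a`. -/
def batteryProb (k : Fin P.K) (b a b' : ℕ) : ℝ :=
  P.lam k * (if b' = P.nextBattery k b 1 a then 1 else 0) +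
    (1 - P.lam k) * (if b' = P.nextBattery k b 0 a then 1 else 0)

/-- The (deterministic) transition probability of the age of information. -/
def ageProb (b age a age' : ℕ) : ℝ := if age' = P.nextAge b age a then 1 else 0

/-- Per-sensor transition probability from `s` to `s'` under command `a`. -/
def sensorTrans (k : Fin P.K) (s : P.SensorState k) (a : Fin 2) (s' : P.SensorState k) : ℝ :=
  P.requestProb k s'.1 * P.batteryProb k s.2.1 a s'.2.1 * P.ageProb s.2.1 s.2.2 a s'.2.2

/-- Transition probability from `s` to `s'` under action `a`. -/
def trans (s : P.State) (a : P.Action) (s' : P.State) : ℝ :=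
  ∏ k, P.sensorTrans k (s k) (a.1 k) (s' k)

/-- A (stationary) randomized policy: a probability distribution on actions for each state. -/
structure Policy where
  prob : P.State → P.Action → ℝ
  prob_nonneg : ∀ s a, 0 ≤ prob s a
  sum_prob : ∀ s, ∑ a, prob s a = 1

/-- The deterministic policy that takes action `f s` in state `s`. -/
def Policy.ofDet {P : Network} (f : P.State → P.Action) : P.Policy where
  prob s a := if a = f s then 1 else 0
  prob_nonneg s a := by split_ifs <;> norm_num
  sum_prob s := by simp

/-- The law of the state at slot `t` when the state at slot `0` is `s₀` and `π` is applied. -/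
def stateLaw (π : P.Policy) (s₀ : P.State) : ℕ → P.State → ℝ
  | 0, s => if s = s₀ then 1 else 0
  | t + 1, s' => ∑ s, ∑ a, stateLaw π s₀ t s * π.prob s a * P.trans s a s'

/-- The expected cost of sensor `k` at slot `t` under `π`, given the state `s₀` at slot `0`. -/
def expSensorCost (π : P.Policy) (s₀ : P.State) (t : ℕ) (k : Fin P.K) : ℝ :=
  ∑ s, ∑ a, P.stateLaw π s₀ t s * π.prob s a * P.sensorCost k (s k) (a.1 k)

/-- `c` is the average cost (average on-demand AoI over all sensors and users) of `π` from `s₀`: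
the limit defining it exists and equals `c`. -/
def HasAverageCost (π : P.Policy) (s₀ : P.State) (c : ℝ) : Prop :=
  Tendsto (fun T : ℕ => 1 / ((P.N : ℝ) * P.K * T) *
    ∑ t ∈ Finset.Icc 1 T, ∑ k, P.expSensorCost π s₀ t k) atTop (𝓝 c)

/-- The bracket `c(s,a) + ∑ s', Pr(s'|s,a) h(s')` of the Bellman equation. -/
def bellmanRHS (h : P.State → ℝ) (s : P.State) (a : P.Action) : ℝ :=
  P.cost s a + ∑ s', P.trans s a s' * h s'

/-- The average-cost Bellman equation `C + h(s) = min_a [c(s,a) + ∑ s', Pr(s'|s,a) h(s')]`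
for all states `s`. -/
def Bellman (C : ℝ) (h : P.State → ℝ) : Prop :=
  ∀ s, IsLeast (Set.range (P.bellmanRHS h s)) (C + h s)

end Network

end

/-! The chain need not be unichain (some `lam k` or `p k n` may be 0 or 1), so a constant gain has
to come from the structure of the network. Couple two copies through the same requests and energy
arrivals, and let the first imitate the actual transmissions of the second. It misses one only when
its battery is empty, and each miss lowers its energy deficit by one, so along every path its total
extra cost is at most a finite potential W (`syncPotential_step`, `potential_step`).

Hence discounted values differ between states by at most W, uniformly in the discount factor
(`FiniteMDP.fixedPoint_sub_le`). Compactness as the discount factor tends to 1 then yields a Bellman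
solution with constant gain C (`FiniteMDP.exists_bellman_solution`).

For a policy with one-step operator E, existence of the average cost is the mean ergodic theorem for
E. The cost C + h - E h has average C by telescoping. The Bellman equation makes it a lower bound
for the cost of any policy, with equality for minimizing actions; this gives optimality, for every
solution h. -/

noncomputable section

/-! ### Average-cost optimality for finite Markov decision processes -/

namespace FiniteMDP

variable {S A Ω : Type*} [Fintype A] [Fintype Ω]

/-- The discounted action value `c(s,a) + α E[v(F(s,a,ω))]`, with transitions driven by a noise
variable `ω` of law `q`. -/
def actionValue (c : S → A → ℝ) (q : Ω → ℝ) (F : S → A → Ω → S) (α : ℝ) (v : S → ℝ)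
    (s : S) (a : A) : ℝ :=
  c s a + α * ∑ ω, q ω * v (F s a ω)

/-- The discounted dynamic programming operator. -/
def bellmanOp [Nonempty A] (c : S → A → ℝ) (q : Ω → ℝ) (F : S → A → Ω → S) (α : ℝ)
    (v : S → ℝ) (s : S) : ℝ :=
  Finset.univ.inf' Finset.univ_nonempty (actionValue c q F α v s)

lemma expect_le_of_le {q : Ω → ℝ} (hq : ∀ ω, 0 ≤ q ω) (hq1 : ∑ ω, q ω = 1) {f : Ω → ℝ} {b : ℝ}
    (h : ∀ ω, f ω ≤ b) : ∑ ω, q ω * f ω ≤ b := by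
  calc ∑ ω, q ω * f ω ≤ ∑ ω, q ω * b :=
        Finset.sum_le_sum fun ω _ => mul_le_mul_of_nonneg_left (h ω) (hq ω)
    _ = b := by rw [← Finset.sum_mul, hq1, one_mul]

section

variable [Nonempty A] {c : S → A → ℝ} {q : Ω → ℝ} {F : S → A → Ω → S} {α : ℝ}

lemma bellmanOp_le (v : S → ℝ) (s : S) (a : A) :
    bellmanOp c q F α v s ≤ actionValue c q F α v s a :=
  Finset.inf'_le _ (Finset.mem_univ a)

lemma exists_bellmanOp_eq (v : S → ℝ) (s : S) :
    ∃ a, bellmanOp c q F α v s = actionValue c q F α v s a := by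
  obtain ⟨a, -, ha⟩ := Finset.exists_mem_eq_inf' Finset.univ_nonempty (actionValue c q F α v s)
  exact ⟨a, ha⟩

variable [Fintype S]

/-- A minimizer for `w` is a competitor for `v`. Used in both directions, this gives the contraction
property. -/
lemma bellmanOp_le_add (hq : ∀ ω, 0 ≤ q ω) (hq1 : ∑ ω, q ω = 1) (hα : 0 ≤ α) (v w : S → ℝ)
    (s : S) : bellmanOp c q F α v s ≤ bellmanOp c q F α w s + α * dist v w := by
  obtain ⟨a, ha⟩ := exists_bellmanOp_eq (c := c) (q := q) (F := F) (α := α) w s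
  refine (bellmanOp_le v s a).trans ?_
  rw [ha, actionValue, actionValue, add_assoc, ← mul_add]
  have h : ∑ ω, q ω * (v (F s a ω) - w (F s a ω)) ≤ dist v w :=
    expect_le_of_le hq hq1 fun ω =>
      (le_abs_self _).trans (by rw [← Real.dist_eq]; exact dist_le_pi_dist v w _)
  simp only [mul_sub, Finset.sum_sub_distrib] at h
  gcongr
  linarith

lemma exists_bellmanOp_fixedPoint (hq : ∀ ω, 0 ≤ q ω) (hq1 : ∑ ω, q ω = 1) (hα : 0 ≤ α)
    (hα1 : α < 1) : ∃ v : S → ℝ, bellmanOp c q F α v = v := by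
  have hc : ContractingWith ⟨α, hα⟩ (bellmanOp c q F α) := by
    refine ⟨by exact_mod_cast hα1, LipschitzWith.of_dist_le_mul fun v w => ?_⟩
    refine (dist_pi_le_iff (mul_nonneg hα dist_nonneg)).2 fun s => ?_
    have h1 := bellmanOp_le_add (c := c) (F := F) hq hq1 hα v w s
    have h2 := bellmanOp_le_add (c := c) (F := F) hq hq1 hα w v s
    rw [dist_comm w v] at h2
    rw [Real.dist_eq, abs_le]
    change -(α * dist v w) ≤ _ ∧ _ ≤ α * dist v w
    constructor <;> linarith
  exact ⟨_, hc.fixedPoint_isFixedPt⟩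

/-- If the gap between two states can be paid for by a potential `W` along a coupling, then the
discounted value function has span bounded by `W`, uniformly in the discount factor. -/
lemma fixedPoint_sub_le {W : S → S → ℝ} (hq : ∀ ω, 0 ≤ q ω) (hq1 : ∑ ω, q ω = 1) (hα : 0 ≤ α)
    (hα1 : α < 1) (hW : ∀ s s', 0 ≤ W s s')
    (hF : ∀ s s' a', ∃ a, ∀ ω, c s a + W (F s a ω) (F s' a' ω) ≤ c s' a' + W s s')
    {v : S → ℝ} (hv : bellmanOp c q F α v = v) (s s' : S) : v s - v s' ≤ W s s' := by
  -- Maximum principle: at a pair maximizing D = v - v' - W, one coupled step gives D ≤ α D, hence D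
  -- ≤ 0.
  obtain ⟨⟨x, x'⟩, -, hx⟩ := Finset.exists_max_image (Finset.univ : Finset (S × S))
    (fun z => v z.1 - v z.2 - W z.1 z.2) ⟨(s, s'), Finset.mem_univ _⟩
  have hmax : ∀ y y', v y - v y' - W y y' ≤ v x - v x' - W x x' :=
    fun y y' => hx (y, y') (Finset.mem_univ _)
  obtain ⟨a', ha'⟩ := exists_bellmanOp_eq (c := c) (q := q) (F := F) (α := α) v x'
  obtain ⟨a, ha⟩ := hF x x' a'
  have h1 : v x ≤ actionValue c q F α v x a := by
    conv_lhs => rw [← hv]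
    exact bellmanOp_le v x a
  rw [hv] at ha'
  unfold actionValue at h1 ha'
  have h2 : ∑ ω, q ω * (v (F x a ω) - v (F x' a' ω) - (c x' a' + W x x' - c x a)) ≤
      v x - v x' - W x x' :=
    expect_le_of_le hq hq1 fun ω => by linarith [ha ω, hmax (F x a ω) (F x' a' ω)]
  have h3 : ∑ ω, q ω * (v (F x a ω) - v (F x' a' ω) - (c x' a' + W x x' - c x a)) =
      ∑ ω, q ω * v (F x a ω) - ∑ ω, q ω * v (F x' a' ω) - (c x' a' + W x x' - c x a) := by
    simp only [mul_sub, Finset.sum_sub_distrib, ← Finset.sum_mul, hq1, one_mul]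
  rw [h3] at h2
  have hΩ : Nonempty Ω := by
    by_contra h
    rw [not_nonempty_iff] at h
    simp at hq1
  -- Discounting the slack of the potential inequality only shrinks it, because the slack dominates
  -- the next value of W, which is nonnegative.
  have h4 : 0 ≤ c x' a' + W x x' - c x a := by
    linarith [ha hΩ.some, hW (F x a hΩ.some) (F x' a' hΩ.some)]
  have h5 := mul_le_mul_of_nonneg_left h2 hα
  have h6 : α * (c x' a' + W x x' - c x a) ≤ c x' a' + W x x' - c x a :=
    mul_le_of_le_one_left h4 hα1.le
  have h7 : v x - v x' - W x x' ≤ α * (v x - v x' - W x x') := by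
    have e1 : α * (∑ ω, q ω * v (F x a ω) - ∑ ω, q ω * v (F x' a' ω)
        - (c x' a' + W x x' - c x a)) = α * ∑ ω, q ω * v (F x a ω)
        - α * ∑ ω, q ω * v (F x' a' ω) - α * (c x' a' + W x x' - c x a) := by ring
    linarith
  have h8 : v x - v x' - W x x' ≤ 0 := by
    by_contra h
    push Not at h
    nlinarith
  linarith [hmax s s']

/-- Keeps the candidate gains `(1 - α) * v s₀` bounded as the discount factor tends to 1. -/
lemma norm_fixedPoint_le (hq : ∀ ω, 0 ≤ q ω) (hq1 : ∑ ω, q ω = 1) (hα : 0 ≤ α)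
    {v : S → ℝ} (hv : bellmanOp c q F α v = v) {b : ℝ} (hb : 0 ≤ b) (hc : ∀ s a, |c s a| ≤ b) :
    (1 - α) * ‖v‖ ≤ b := by
  have key : ‖v‖ ≤ b + α * ‖v‖ := by
    refine (pi_norm_le_iff_of_nonneg (by positivity)).2 fun s => ?_
    obtain ⟨a, ha⟩ := exists_bellmanOp_eq (c := c) (q := q) (F := F) (α := α) v s
    rw [hv] at ha
    rw [ha, actionValue]
    refine (norm_add_le _ _).trans (add_le_add (hc s a) ?_)
    rw [norm_mul, Real.norm_of_nonneg hα]
    refine mul_le_mul_of_nonneg_left ((norm_sum_le _ _).trans ?_) hα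
    simp only [norm_mul, Real.norm_of_nonneg (hq _)]
    exact expect_le_of_le hq hq1 fun ω => norm_le_pi_norm v _
  linarith

/-- Vanishing discount: a finite Markov decision process with a coupling potential has a solution
of the average-cost Bellman equation with constant gain. -/
theorem exists_bellman_solution {W : S → S → ℝ} (hq : ∀ ω, 0 ≤ q ω) (hq1 : ∑ ω, q ω = 1)
    (hW : ∀ s s', 0 ≤ W s s')
    (hF : ∀ s s' a', ∃ a, ∀ ω, c s a + W (F s a ω) (F s' a' ω) ≤ c s' a' + W s s') (s₀ : S) :
    ∃ (g : ℝ) (h : S → ℝ), ∀ s,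
      IsLeast (Set.range fun a => c s a + ∑ ω, q ω * h (F s a ω)) (g + h s) := by
  obtain ⟨b, hb⟩ : ∃ b, ∀ s a, |c s a| ≤ b :=
    ⟨∑ s, ∑ a, |c s a|, fun s a =>
      (Finset.single_le_sum (f := fun a => |c s a|) (fun _ _ => abs_nonneg _)
        (Finset.mem_univ a)).trans
      (Finset.single_le_sum (f := fun s => ∑ a, |c s a|)
        (fun _ _ => Finset.sum_nonneg fun _ _ => abs_nonneg _) (Finset.mem_univ s))⟩
  have hb0 : 0 ≤ b := (abs_nonneg _).trans (hb s₀ (Classical.arbitrary A))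
  set α : ℕ → ℝ := fun n => 1 - 1 / ((n : ℝ) + 1) with hα
  have hα0 : ∀ n, 0 ≤ α n := fun n => by
    have : 1 / ((n : ℝ) + 1) ≤ 1 := by
      rw [div_le_one (by positivity)]; linarith [n.cast_nonneg (α := ℝ)]
    simp only [hα]; linarith
  have hα1 : ∀ n, α n < 1 := fun n => by
    have : 0 < 1 / ((n : ℝ) + 1) := by positivity
    simp only [hα]; linarith
  have hαlim : Tendsto α atTop (𝓝 1) := by
    simpa [hα] using (tendsto_const_nhds (x := (1 : ℝ))).sub
      (tendsto_one_div_add_atTop_nhds_zero_nat (𝕜 := ℝ))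
  choose v hv using fun n =>
    exists_bellmanOp_fixedPoint (S := S) (c := c) (F := F) hq hq1 (hα0 n) (hα1 n)
  -- Values themselves may blow up; the pair (scaled value at `s₀`, values relative to `s₀`) stays
  -- bounded, and its limit points are the pairs (gain, bias).
  set x : ℕ → ℝ × (S → ℝ) := fun n => ((1 - α n) * v n s₀, fun s => v n s - v n s₀) with hx
  have hbd : ∀ n, x n ∈ Metric.closedBall (0 : ℝ × (S → ℝ))
      (b + ∑ s, ∑ s', W s s') := fun n => by
    have hWs : ∀ s s', W s s' ≤ ∑ s, ∑ s', W s s' := fun s s' =>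
      (Finset.single_le_sum (f := fun s' => W s s') (fun _ _ => hW _ _)
        (Finset.mem_univ s')).trans
      (Finset.single_le_sum (f := fun s => ∑ s', W s s')
        (fun _ _ => Finset.sum_nonneg fun _ _ => hW _ _) (Finset.mem_univ s))
    have hW0 := (hW s₀ s₀).trans (hWs s₀ s₀)
    rw [mem_closedBall_zero_iff, Prod.norm_def]
    refine max_le ?_ ((pi_norm_le_iff_of_nonneg (by positivity)).2 fun s => ?_)
    · have h1 := norm_fixedPoint_le hq hq1 (hα0 n) (hv n) hb0 hb
      simp only [hx]
      rw [norm_mul, Real.norm_of_nonneg (by linarith [hα1 n])]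
      have := mul_le_mul_of_nonneg_left (norm_le_pi_norm (v n) s₀)
        (show 0 ≤ 1 - α n by linarith [hα1 n])
      linarith
    · simp only [hx]
      rw [Real.norm_eq_abs, abs_le]
      have h1 := fixedPoint_sub_le hq hq1 (hα0 n) (hα1 n) hW hF (hv n) s s₀
      have h2 := fixedPoint_sub_le hq hq1 (hα0 n) (hα1 n) hW hF (hv n) s₀ s
      have h3 := hWs s s₀
      have h4 := hWs s₀ s
      constructor <;> linarith
  obtain ⟨⟨g, h⟩, -, φ, hφ, hlim⟩ := tendsto_subseq_of_bounded Metric.isBounded_closedBall hbd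
  have hg : Tendsto (fun n => (x (φ n)).1) atTop (𝓝 g) := (continuous_fst.tendsto _).comp hlim
  have hh : ∀ s, Tendsto (fun n => (x (φ n)).2 s) atTop (𝓝 (h s)) := fun s =>
    (tendsto_pi_nhds.1 ((continuous_snd.tendsto _).comp hlim)) s
  have hαφ : Tendsto (fun n => α (φ n)) atTop (𝓝 1) := hαlim.comp hφ.tendsto_atTop
  have hval : ∀ s a, Tendsto (fun n => actionValue c q F (α (φ n)) (x (φ n)).2 s a) atTop
      (𝓝 (actionValue c q F 1 h s a)) := fun s a =>
    tendsto_const_nhds.add (hαφ.mul (tendsto_finsetSum _ fun ω _ => (hh _).const_mul _))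
  have hshift : ∀ n s a, actionValue c q F (α n) (x n).2 s a =
      actionValue c q F (α n) (v n) s a - α n * v n s₀ := fun n s a => by
    simp only [actionValue, hx, mul_sub, Finset.sum_sub_distrib, ← Finset.sum_mul, hq1, one_mul]
    ring
  refine ⟨g, h, fun s => ?_⟩
  have hle : ∀ a, g + h s ≤ actionValue c q F 1 h s a := fun a => by
    refine le_of_tendsto_of_tendsto' (hg.add (hh s)) (hval s a) fun n => ?_
    have := bellmanOp_le (c := c) (q := q) (F := F) (α := α (φ n)) (v (φ n)) s a
    rw [hv] at this
    rw [hshift]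
    simp only [hx]
    linarith
  have hinf : g + h s = bellmanOp c q F 1 h s := by
    have h1 : Tendsto (fun n => bellmanOp c q F (α (φ n)) (x (φ n)).2 s) atTop
        (𝓝 (bellmanOp c q F 1 h s)) :=
      Filter.Tendsto.finset_inf'_nhds_apply Finset.univ_nonempty fun a _ => hval s a
    refine tendsto_nhds_unique ((hg.add (hh s)).congr fun n => ?_) h1
    obtain ⟨a, ha⟩ := exists_bellmanOp_eq (c := c) (q := q) (F := F) (α := α (φ n)) (v (φ n)) s
    obtain ⟨a', ha'⟩ :=
      exists_bellmanOp_eq (c := c) (q := q) (F := F) (α := α (φ n)) (x (φ n)).2 s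
    have h2 := bellmanOp_le (c := c) (q := q) (F := F) (α := α (φ n)) (v (φ n)) s a'
    have h3 := bellmanOp_le (c := c) (q := q) (F := F) (α := α (φ n)) (x (φ n)).2 s a
    rw [hshift] at ha' h3
    rw [hv] at ha h2
    simp only [hx] at ha' h3 ⊢
    linarith
  obtain ⟨a, ha⟩ := exists_bellmanOp_eq (c := c) (q := q) (F := F) (α := 1) h s
  refine ⟨⟨a, ?_⟩, ?_⟩
  · rw [hinf, ha, actionValue, one_mul]
  · rintro _ ⟨a, rfl⟩
    simpa [actionValue] using hle a

end

end FiniteMDP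

/-! ### Mean ergodic theorem in finite dimension -/

/-- Cesàro averages of the iterates of a linear contraction of a finite-dimensional space
converge. -/
theorem LinearMap.exists_tendsto_cesaro {E : Type*} [NormedAddCommGroup E] [NormedSpace ℝ E]
    [FiniteDimensional ℝ E] (f : E →ₗ[ℝ] E) (hf : ∀ v, ‖f v‖ ≤ ‖v‖) (v : E) :
    ∃ w, Tendsto (fun T : ℕ => (T : ℝ)⁻¹ • ∑ t ∈ Finset.Icc 1 T, (f ^ t) v) atTop (𝓝 w) := by
  have hpow : ∀ n x, ‖(f ^ n) x‖ ≤ ‖x‖ := fun n => by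
    induction n with
    | zero => simp
    | succ n ih => intro x; rw [pow_succ']; exact (hf _).trans (ih x)
  have hinv : Tendsto (fun T : ℕ => (T : ℝ)⁻¹) atTop (𝓝 0) := tendsto_inv_atTop_nhds_zero_nat
  have hbdd : ∀ (u : ℕ → E) (b : ℝ), (∀ n, ‖u n‖ ≤ b) →
      Tendsto (fun T : ℕ => (T : ℝ)⁻¹ • u T) atTop (𝓝 0) := fun u b hu => by
    refine squeeze_zero_norm (a := fun T : ℕ => (T : ℝ)⁻¹ * b) (fun T => ?_)
      (by simpa using hinv.mul_const b)
    rw [norm_smul, Real.norm_of_nonneg (by positivity)]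
    exact mul_le_mul_of_nonneg_left (hu T) (by positivity)
  have hne : ∀ᶠ T : ℕ in atTop, (T : ℝ) ≠ 0 :=
    (eventually_ne_atTop 0).mono fun T hT => by exact_mod_cast hT
  have hdisj : Disjoint (LinearMap.ker (f - 1)) (LinearMap.range (f - 1)) := by
    rw [Submodule.disjoint_def]
    rintro y hy ⟨x, rfl⟩
    set y := (f - 1) x with hyx
    have hfy : f y = y := sub_eq_zero.1 hy
    have hfx : f x = x + y := by simp [hyx]
    -- A nonzero fixed vector in the range of `f - 1` would make an orbit grow linearly, against the
    -- contraction bound.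
    have hn : ∀ n : ℕ, (f ^ n) x = x + (n : ℝ) • y := fun n => by
      induction n with
      | zero => simp
      | succ n ih =>
        rw [pow_succ', Module.End.mul_apply, ih, map_add, map_smul, hfx, hfy]
        push_cast
        module
    have h1 := hbdd (fun n => (f ^ n) x - x) (‖x‖ + ‖x‖)
      fun n => (norm_sub_le _ _).trans (add_le_add_left (hpow n x) _)
    refine tendsto_nhds_unique (tendsto_const_nhds.congr' ?_) h1
    filter_upwards [hne] with T hT
    rw [hn, add_sub_cancel_left, smul_smul, inv_mul_cancel₀ hT, one_smul]
  -- Rank-nullity turns disjointness into a decomposition: averages are constant on the kernel and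
  -- telescope to 0 on the range.
  have htop : LinearMap.ker (f - 1) ⊔ LinearMap.range (f - 1) = ⊤ := by
    refine Submodule.eq_top_of_disjoint _ _ ?_ hdisj
    rw [add_comm]
    exact (LinearMap.finrank_range_add_finrank_ker (f - 1)).ge
  obtain ⟨k, hk, _, ⟨x, rfl⟩, rfl⟩ := Submodule.mem_sup.1 (htop ▸ Submodule.mem_top (x := v))
  have hfk : ∀ t : ℕ, (f ^ t) k = k := fun t => by
    induction t with
    | zero => simp
    | succ t ih => rw [pow_succ', Module.End.mul_apply, ih]; exact sub_eq_zero.1 hk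
  have hsum : ∀ T : ℕ, ∑ t ∈ Finset.Icc 1 T, (f ^ t) (k + (f - 1) x) =
      (T : ℝ) • k + ((f ^ (T + 1)) x - f x) := fun T => by
    induction T with
    | zero => simp
    | succ T ih =>
      rw [Finset.sum_Icc_succ_top (by omega), ih, map_add, hfk, LinearMap.sub_apply, map_sub,
        Module.End.one_apply, pow_succ f (T + 1), Module.End.mul_apply]
      push_cast
      module
  refine ⟨k, ?_⟩
  have h1 := hbdd (fun n => (f ^ (n + 1)) x - f x) (‖x‖ + ‖f x‖)
    fun n => (norm_sub_le _ _).trans (add_le_add_left (hpow _ x) _)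
  have h2 := (tendsto_const_nhds (x := k)).add h1
  rw [add_zero] at h2
  refine h2.congr' ?_
  filter_upwards [hne] with T hT
  rw [hsum, smul_add, smul_smul, inv_mul_cancel₀ hT, one_smul]

end
noncomputable section

namespace Network

variable (P : Network)

/-! ### The transition kernel driven by independent request and energy noise -/

lemma sends_le {b a : ℕ} (ha : a ≤ 1) : sends b a ≤ b := by
  unfold sends
  split_ifs <;> omega

lemma sends_le_left (b a : ℕ) : sends b a ≤ a := by
  unfold sends
  split_ifs <;> omega

lemma nextAge_mem (b age a : ℕ) : P.nextAge b age a ∈ Finset.Icc 1 P.Dmax := by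
  have := P.Dmax_pos
  rw [Finset.mem_Icc, nextAge]
  omega

/-- The noise acting on one sensor: the next number of requests and the energy arrival. -/
abbrev SensorNoise (P : Network) : Type := Fin (P.N + 1) × Fin 2

/-- The noise acting on the network. -/
abbrev Noise (P : Network) : Type := Fin P.K → P.SensorNoise

/-- The law of the energy arrival. -/
def energyProb (k : Fin P.K) (e : Fin 2) : ℝ := if e = 1 then P.lam k else 1 - P.lam k

/-- The law of the noise of one sensor. -/
def sensorNoiseProb (k : Fin P.K) (ω : P.SensorNoise) : ℝ :=
  P.requestProb k ω.1 * P.energyProb k ω.2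

/-- The law of the noise. -/
def noiseProb (ω : P.Noise) : ℝ := ∏ k, P.sensorNoiseProb k (ω k)

/-- The next state of a sensor as a function of the noise. -/
def sensorStep (k : Fin P.K) (s : P.SensorState k) (a : Fin 2) (ω : P.SensorNoise) :
    P.SensorState k :=
  (ω.1, ⟨P.nextBattery k s.2.1 ω.2 a, Nat.lt_succ_of_le (min_le_right _ _)⟩,
    ⟨P.nextAge s.2.1 s.2.2 a, P.nextAge_mem _ _ _⟩)

/-- The next state of the network as a function of the noise. -/
def step (s : P.State) (a : P.Action) (ω : P.Noise) : P.State :=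
  fun k => P.sensorStep k (s k) (a.1 k) (ω k)

lemma requestProb_nonneg (k : Fin P.K) (r : ℕ) : 0 ≤ P.requestProb k r :=
  Finset.sum_nonneg fun _ _ => mul_nonneg (Finset.prod_nonneg fun n _ => P.p_nonneg k n)
    (Finset.prod_nonneg fun n _ => sub_nonneg.2 (P.p_le_one k n))

/-- Expand ∏ (p + (1 - p)) = 1 over subsets of users and group them by cardinality. -/
lemma sum_requestProb (k : Fin P.K) : ∑ r : Fin (P.N + 1), P.requestProb k r = 1 := by
  have h := Fintype.prod_add (P.p k) (fun n => 1 - P.p k n)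
  simp only [add_sub_cancel, Finset.prod_const_one] at h
  rw [h, ← Finset.powerset_univ, Finset.sum_powerset, Finset.card_univ, Fintype.card_fin,
    Fin.sum_univ_eq_sum_range (fun r => P.requestProb k r) (P.N + 1)]
  rfl

lemma energyProb_nonneg (k : Fin P.K) (e : Fin 2) : 0 ≤ P.energyProb k e := by
  unfold energyProb
  split_ifs
  · exact P.lam_nonneg k
  · exact sub_nonneg.2 (P.lam_le_one k)

lemma sum_energyProb (k : Fin P.K) : ∑ e, P.energyProb k e = 1 := by
  simp [energyProb, Fin.sum_univ_two]

lemma noiseProb_nonneg (ω : P.Noise) : 0 ≤ P.noiseProb ω :=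
  Finset.prod_nonneg fun k _ => mul_nonneg (P.requestProb_nonneg k _) (P.energyProb_nonneg k _)

lemma sum_noiseProb : ∑ ω, P.noiseProb ω = 1 := by
  unfold noiseProb
  rw [← Fintype.prod_sum]
  refine Finset.prod_eq_one fun k _ => ?_
  simp only [sensorNoiseProb, Fintype.sum_prod_type, ← Finset.mul_sum, sum_energyProb, mul_one,
    sum_requestProb]

lemma sensorTrans_eq (k : Fin P.K) (s : P.SensorState k) (a : Fin 2) (s' : P.SensorState k) :
    P.sensorTrans k s a s' =
      ∑ ω, if s' = P.sensorStep k s a ω then P.sensorNoiseProb k ω else 0 := by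
  have h : ∀ ω : P.SensorNoise,
      (if s' = P.sensorStep k s a ω then P.sensorNoiseProb k ω else 0) =
      if s'.1 = ω.1 then P.requestProb k s'.1 * (P.energyProb k ω.2 *
        (if (s'.2.1 : ℕ) = P.nextBattery k s.2.1 ω.2 a then 1 else 0)) *
        P.ageProb s.2.1 s.2.2 a s'.2.2 else 0 := fun ω => by
    obtain ⟨r', b', d'⟩ := s'
    obtain ⟨r, e⟩ := ω
    simp only [sensorStep, sensorNoiseProb, ageProb, Prod.mk.injEq, Fin.ext_iff, Subtype.ext_iff]
    split_ifs <;> simp_all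
  simp only [h, Fintype.sum_prod_type]
  rw [Finset.sum_comm]
  simp only [Finset.sum_ite_eq, Finset.mem_univ, if_true, Fin.sum_univ_two, sensorTrans,
    batteryProb, energyProb]
  simp only [zero_ne_one, if_false, Fin.val_zero, Fin.val_one]
  ring

/-- The noise law depends on neither state nor action, which is what allows two copies to share it.
-/
lemma trans_eq (s : P.State) (a : P.Action) (s' : P.State) :
    P.trans s a s' = ∑ ω, if s' = P.step s a ω then P.noiseProb ω else 0 := by
  simp only [trans, sensorTrans_eq, Fintype.prod_sum]
  refine Finset.sum_congr rfl fun ω _ => ?_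
  simp only [funext_iff, step, noiseProb]
  split_ifs with h
  · exact Finset.prod_congr rfl fun k _ => if_pos (h k)
  · push Not at h
    obtain ⟨k, hk⟩ := h
    exact Finset.prod_eq_zero (Finset.mem_univ k) (if_neg hk)

lemma sum_trans_mul (s : P.State) (a : P.Action) (h : P.State → ℝ) :
    ∑ s', P.trans s a s' * h s' = ∑ ω, P.noiseProb ω * h (P.step s a ω) := by
  simp only [trans_eq, Finset.sum_mul, ite_mul, zero_mul]
  rw [Finset.sum_comm]
  simp

lemma trans_nonneg (s : P.State) (a : P.Action) (s' : P.State) : 0 ≤ P.trans s a s' := by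
  rw [trans_eq]
  exact Finset.sum_nonneg fun ω _ => by split_ifs <;> simp [P.noiseProb_nonneg]

lemma sum_trans (s : P.State) (a : P.Action) : ∑ s', P.trans s a s' = 1 := by
  simpa [sum_noiseProb] using P.sum_trans_mul s a fun _ => 1

/-! ### The coupling potential

Two copies of a sensor see the same requests and energy arrivals. The first copy imitates the
transmissions of the second one as long as its battery allows. -/

/-- The cost of resynchronizing the ages, when no transmission is missed. -/
def agePotential (x y : ℕ) : ℕ := if x ≤ y then 0 else P.Dmax * (P.Dmax - y)

/-- The cost of all transmissions that will be missed, and of resynchronizing the ages. -/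
def syncPotential (b b' x x' : ℕ) : ℕ := P.Dmax ^ 2 * (b' - b) + P.agePotential x x'

/-- A bound on the total extra cost of a sensor imitating another copy of it. -/
def sensorPotential (k : Fin P.K) (s s' : P.SensorState k) : ℕ :=
  P.N * ((if s.1 = s'.1 then 0 else P.Dmax) + P.syncPotential s.2.1 s'.2.1 s.2.2 s'.2.2)

/-- Subtraction is truncated: only an excess age of the imitator is charged, and only a deficit of
its battery is stored. -/
lemma syncPotential_step (k : Fin P.K) {b b' x x' a e : ℕ} (ha : a ≤ 1)
    (hx : x ≤ P.Dmax) :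
    (P.nextAge b x (sends b' a) - P.nextAge b' x' a) +
      P.syncPotential (P.nextBattery k b e (sends b' a)) (P.nextBattery k b' e a)
        (P.nextAge b x (sends b' a)) (P.nextAge b' x' a) ≤ P.syncPotential b b' x x' := by
  have hD := P.Dmax_pos
  have hmono : ∀ m n : ℕ, m ≤ n → P.Dmax ^ 2 * m ≤ P.Dmax ^ 2 * n :=
    fun m n h => Nat.mul_le_mul_left _ h
  have hsync : ∀ {y y' : ℕ}, y = min (x + 1) P.Dmax → y' = min (x' + 1) P.Dmax →
      (y - y') + P.agePotential y y' ≤ P.agePotential x x' := by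
    intro y y' hy hy'
    unfold agePotential
    split_ifs with h1 h2 h2
    · omega
    · omega
    · omega
    -- Since y' < y ≤ `P.Dmax`, the age y' is not capped, so the potential falls by `P.Dmax`, which
    -- pays for the gap.
    · have h3 : P.Dmax - x' = (P.Dmax - y') + 1 := by omega
      rw [h3, mul_add, mul_one]
      omega
  by_cases hd : sends b' a = 0
  · have hs : sends b 0 = 0 := by simp [sends]
    have hb : P.nextBattery k b' e a - P.nextBattery k b e (sends b' a) ≤ b' - b := by
      simp only [nextBattery, hd, hs]
      omega
    have h1 := hmono _ _ hb
    have h2 := hsync (y := P.nextAge b x (sends b' a)) (y' := P.nextAge b' x' a)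
      (by simp [nextAge, hd, hs]) (by simp [nextAge, hd])
    unfold syncPotential
    omega
  · have hd1 : sends b' a = 1 := by have := sends_le_left b' a; omega
    have hb' : 1 ≤ b' := by have := sends_le (b := b') ha; omega
    have hy' : P.nextAge b' x' a = 1 := by simp [nextAge, hd1]; omega
    rw [hd1, hy']
    by_cases hb : 1 ≤ b
    · have hs : sends b 1 = 1 := by simp [sends, hb]
      have hy : P.nextAge b x 1 = 1 := by simp [nextAge, hs]; omega
      have h1 : P.nextBattery k b' e a - P.nextBattery k b e 1 ≤ b' - b := by
        simp only [nextBattery, hd1, hs]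
        omega
      have h2 := hmono _ _ h1
      rw [hy]
      unfold syncPotential
      simp only [agePotential, le_refl, if_true]
      omega
    -- A missed transmission: the deficit drops by one and frees `P.Dmax ^ 2`, covering the present
    -- age gap (at most `P.Dmax`) and the new age potential (at most `P.Dmax * (P.Dmax - 1)`).
    · have hs : sends b 1 = 0 := by simp [sends, hb]
      have h1 : P.nextBattery k b' e a - P.nextBattery k b e 1 ≤ b' - b - 1 := by
        simp only [nextBattery, hd1, hs]
        omega
      have h2 := hmono _ _ h1
      have h3 : b' - b = (b' - b - 1) + 1 := by omega
      have h4 : P.Dmax ^ 2 * (b' - b) = P.Dmax ^ 2 * (b' - b - 1) + P.Dmax ^ 2 := by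
        rw [h3]; simp [mul_add]
      have h5 : P.nextAge b x 1 ≤ P.Dmax := min_le_right _ _
      have h6 : P.agePotential (P.nextAge b x 1) 1 ≤ P.Dmax * (P.Dmax - 1) := by
        unfold agePotential
        split_ifs <;> simp
      have h7 : P.Dmax ^ 2 = P.Dmax * (P.Dmax - 1) + P.Dmax := by
        obtain ⟨m, hm⟩ : ∃ m, P.Dmax = m + 1 := ⟨P.Dmax - 1, by omega⟩
        rw [hm, Nat.add_sub_cancel]
        ring
      unfold syncPotential
      omega

/-- The imitating command: transmit when the other copy does. -/
def imitate (s' : P.State) (a : P.Action) : P.Action :=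
  ⟨fun k => ⟨sends (s' k).2.1 (a.1 k), (sends_le_left _ _).trans_lt (a.1 k).2⟩,
    (Finset.sum_le_sum fun _ _ => sends_le_left _ _).trans a.2⟩

/-- After one shared step the request counts agree, so a mismatch is paid for once, by `P.N *
P.Dmax`. With equal counts, at most `P.N` requests each pay the age gap. -/
lemma sensorPotential_step (k : Fin P.K) (s s' : P.State) (a : P.Action) (ω : P.Noise) :
    P.sensorCost k (s k) ((P.imitate s' a).1 k) +
      P.sensorPotential k (P.step s (P.imitate s' a) ω k) (P.step s' a ω k) ≤
    P.sensorCost k (s' k) (a.1 k) + P.sensorPotential k (s k) (s' k) := by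
  have hstep := P.syncPotential_step k (b := (s k).2.1) (b' := (s' k).2.1) (x := (s k).2.2)
    (x' := (s' k).2.2) (a := a.1 k) (e := (ω k).2) (by omega)
    (Finset.mem_Icc.1 (s k).2.2.2).2
  have hr : ((s k).1 : ℕ) ≤ P.N := by omega
  have hy : P.nextAge (s k).2.1 (s k).2.2 (sends (s' k).2.1 (a.1 k)) ≤ P.Dmax := min_le_right _ _
  simp only [sensorCost, sensorPotential, step, sensorStep, imitate, if_true, zero_add]
  norm_cast
  generalize P.syncPotential (P.nextBattery k _ _ _) _ _ _ = u at hstep ⊢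
  generalize P.syncPotential _ _ _ _ = w at hstep ⊢
  generalize P.nextAge (s k).2.1 (s k).2.2 (sends (s' k).2.1 (a.1 k)) = y at hstep hy ⊢
  generalize P.nextAge (s' k).2.1 _ _ = y' at hstep ⊢
  have h1 := Nat.mul_le_mul_left P.N hstep
  rw [mul_add] at h1
  split_ifs with h
  · rw [← h, zero_add]
    have h2 : ((s k).1 : ℕ) * y ≤ ((s k).1 : ℕ) * y' + P.N * (y - y') := by
      calc ((s k).1 : ℕ) * y ≤ ((s k).1 : ℕ) * (y' + (y - y')) :=
            Nat.mul_le_mul_left _ (by omega)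
        _ = ((s k).1 : ℕ) * y' + ((s k).1 : ℕ) * (y - y') := mul_add _ _ _
        _ ≤ _ := Nat.add_le_add_left (Nat.mul_le_mul_right _ hr) _
    omega
  · have h2 : ((s k).1 : ℕ) * y ≤ P.N * P.Dmax := Nat.mul_le_mul hr hy
    rw [mul_add]
    omega

/-- A bound on the total extra average cost of a network imitating another copy of it. -/
def potential (s s' : P.State) : ℝ :=
  1 / ((P.N : ℝ) * P.K) * ∑ k, (P.sensorPotential k (s k) (s' k) : ℝ)

lemma potential_nonneg (s s' : P.State) : 0 ≤ P.potential s s' := by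
  unfold potential
  positivity

lemma potential_step (s s' : P.State) (a : P.Action) (ω : P.Noise) :
    P.cost s (P.imitate s' a) + P.potential (P.step s (P.imitate s' a) ω) (P.step s' a ω) ≤
      P.cost s' a + P.potential s s' := by
  simp only [cost, potential, ← mul_add, ← Finset.sum_add_distrib]
  exact mul_le_mul_of_nonneg_left
    (Finset.sum_le_sum fun k _ => P.sensorPotential_step k s s' a ω) (by positivity)

instance : Nonempty P.Action := ⟨⟨fun _ => 0, by simp⟩⟩

instance : Nonempty P.State :=
  ⟨fun _ => (0, 0, ⟨1, Finset.mem_Icc.2 ⟨le_rfl, P.Dmax_pos⟩⟩)⟩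

/-- The average-cost Bellman equation has a solution. -/
theorem exists_bellman : ∃ (C : ℝ) (h : P.State → ℝ), P.Bellman C h := by
  obtain ⟨g, h, hgh⟩ := FiniteMDP.exists_bellman_solution (c := P.cost) (F := P.step)
    P.noiseProb_nonneg P.sum_noiseProb P.potential_nonneg
    (fun s s' a => ⟨P.imitate s' a, fun ω => P.potential_step s s' a ω⟩)
    (Classical.arbitrary P.State)
  refine ⟨g, h, fun s => ?_⟩
  have hR : P.bellmanRHS h s =
      fun a => P.cost s a + ∑ ω, P.noiseProb ω * h (P.step s a ω) :=
    funext fun a => congrArg _ (P.sum_trans_mul s a h)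
  rw [hR]
  exact hgh s

/-! ### Average costs of policies -/

variable {P}

/-- The one-step expectation operator of a policy. -/
def Policy.expect (π : P.Policy) : (P.State → ℝ) →ₗ[ℝ] (P.State → ℝ) where
  toFun v s := ∑ a, π.prob s a * ∑ s', P.trans s a s' * v s'
  map_add' v w := by
    ext s
    simp only [Pi.add_apply, mul_add, Finset.sum_add_distrib]
  map_smul' r v := by
    ext s
    simp only [Pi.smul_apply, smul_eq_mul, RingHom.id_apply, Finset.mul_sum]
    exact Finset.sum_congr rfl fun a _ => Finset.sum_congr rfl fun s' _ => by ring

/-- The expected one-step cost of a policy. -/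
def Policy.expCost (π : P.Policy) (s : P.State) : ℝ := ∑ a, π.prob s a * P.cost s a

lemma Policy.expect_apply (π : P.Policy) (v : P.State → ℝ) (s : P.State) :
    π.expect v s = ∑ a, π.prob s a * ∑ s', P.trans s a s' * v s' := rfl

lemma Policy.expect_mono (π : P.Policy) {v w : P.State → ℝ} (h : v ≤ w) :
    π.expect v ≤ π.expect w := fun s =>
  Finset.sum_le_sum fun a _ => mul_le_mul_of_nonneg_left
    (Finset.sum_le_sum fun s' _ => mul_le_mul_of_nonneg_left (h s') (P.trans_nonneg s a s'))
    (π.prob_nonneg s a)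

lemma Policy.expect_const (π : P.Policy) (r : ℝ) :
    π.expect (fun _ => r) = fun _ => r := by
  ext s
  simp only [expect_apply, ← Finset.sum_mul, sum_trans, one_mul, π.sum_prob]

lemma Policy.norm_expect_le (π : P.Policy) (v : P.State → ℝ) : ‖π.expect v‖ ≤ ‖v‖ := by
  refine (pi_norm_le_iff_of_nonneg (norm_nonneg _)).2 fun s => ?_
  have h : ∀ s, |v s| ≤ ‖v‖ := fun s => norm_le_pi_norm v s
  have h1 := π.expect_mono (v := v) (w := fun _ => ‖v‖) (fun s => (abs_le.1 (h s)).2) s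
  have h2 := π.expect_mono (v := fun _ => -‖v‖) (w := v) (fun s => (abs_le.1 (h s)).1) s
  rw [π.expect_const] at h1 h2
  exact abs_le.2 ⟨h2, h1⟩

/-- Duality between pushing the law forward and pulling `v` back; the last slot is absorbed into
`v`, hence the generalization. -/
lemma sum_stateLaw_mul (π : P.Policy) (s₀ : P.State) (t : ℕ) (v : P.State → ℝ) :
    ∑ s, P.stateLaw π s₀ t s * v s = (π.expect ^ t) v s₀ := by
  induction t generalizing v with
  | zero => simp [stateLaw]
  | succ t ih =>
    rw [pow_succ, Module.End.mul_apply, ← ih]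
    simp only [stateLaw, Policy.expect_apply, Finset.sum_mul, Finset.mul_sum]
    rw [Finset.sum_comm]
    refine Finset.sum_congr rfl fun s _ => ?_
    rw [Finset.sum_comm]
    exact Finset.sum_congr rfl fun a _ => Finset.sum_congr rfl fun s' _ => by ring

lemma sum_expSensorCost (π : P.Policy) (s₀ : P.State) (t : ℕ) :
    ∑ k, P.expSensorCost π s₀ t k = P.N * P.K * (π.expect ^ t) π.expCost s₀ := by
  have hN : (P.N : ℝ) ≠ 0 := by exact_mod_cast (Nat.one_le_iff_ne_zero.1 P.N_pos)
  have hK : (P.K : ℝ) ≠ 0 := by exact_mod_cast (Nat.one_le_iff_ne_zero.1 P.K_pos)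
  have hc : ∀ s a, ∑ k, P.sensorCost k (s k) (a.1 k) = P.N * P.K * P.cost s a := fun s a => by
    unfold cost
    field_simp
  rw [← sum_stateLaw_mul]
  simp only [expSensorCost]
  rw [Finset.sum_comm, Finset.mul_sum]
  refine Finset.sum_congr rfl fun s _ => ?_
  rw [Finset.sum_comm]
  simp only [← Finset.mul_sum, hc, Policy.expCost]
  rw [Finset.mul_sum, Finset.mul_sum]
  exact Finset.sum_congr rfl fun a _ => by ring

lemma hasAverageCost_iff (π : P.Policy) (s₀ : P.State) (c : ℝ) :
    P.HasAverageCost π s₀ c ↔ Tendsto (fun T : ℕ => (T : ℝ)⁻¹ *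
      ∑ t ∈ Finset.Icc 1 T, (π.expect ^ t) π.expCost s₀) atTop (𝓝 c) := by
  have hN : (P.N : ℝ) ≠ 0 := by exact_mod_cast (Nat.one_le_iff_ne_zero.1 P.N_pos)
  have hK : (P.K : ℝ) ≠ 0 := by exact_mod_cast (Nat.one_le_iff_ne_zero.1 P.K_pos)
  unfold HasAverageCost
  refine iff_of_eq (congrArg (fun f => Tendsto f atTop (𝓝 c)) (funext fun T => ?_))
  simp only [sum_expSensorCost, ← Finset.mul_sum]
  rcases eq_or_ne (T : ℝ) 0 with hT | hT
  · simp [hT]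
  · field_simp

lemma exists_hasAverageCost (π : P.Policy) (s₀ : P.State) : ∃ c, P.HasAverageCost π s₀ c := by
  obtain ⟨w, hw⟩ := π.expect.exists_tendsto_cesaro π.norm_expect_le π.expCost
  refine ⟨w s₀, (hasAverageCost_iff π s₀ _).2 ?_⟩
  simpa using tendsto_pi_nhds.1 hw s₀

lemma Policy.expect_pow_mono (π : P.Policy) (t : ℕ) {v w : P.State → ℝ} (h : v ≤ w) :
    (π.expect ^ t) v ≤ (π.expect ^ t) w := by
  induction t with
  | zero => simpa
  | succ t ih =>
    rw [pow_succ', Module.End.mul_apply, Module.End.mul_apply]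
    exact π.expect_mono ih

/-- The cost `C + h - E_π h` has average `C` under `π`, by telescoping. -/
lemma tendsto_average_telescope (π : P.Policy) (s₀ : P.State) (C : ℝ) (h : P.State → ℝ) :
    Tendsto (fun T : ℕ => (T : ℝ)⁻¹ * ∑ t ∈ Finset.Icc 1 T,
      (π.expect ^ t) ((fun _ => C) + h - π.expect h) s₀) atTop (𝓝 C) := by
  have hconst : ∀ t : ℕ, (π.expect ^ t) (fun _ => C) = fun _ => C := fun t => by
    induction t with
    | zero => simp
    | succ t ih => rw [pow_succ', Module.End.mul_apply, ih, π.expect_const]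
  have hbd : ∀ t : ℕ, |(π.expect ^ t) h s₀| ≤ ‖h‖ := fun t => by
    refine (norm_le_pi_norm ((π.expect ^ t) h) s₀).trans ?_
    induction t with
    | zero => simp
    | succ t ih =>
      rw [pow_succ', Module.End.mul_apply]
      exact (π.norm_expect_le _).trans ih
  -- Slots are counted from 1, so the boundary terms carry the exponents 1 and T + 1.
  have hsum : ∀ T : ℕ, ∑ t ∈ Finset.Icc 1 T,
      (π.expect ^ t) ((fun _ => C) + h - π.expect h) s₀ =
      T * C + ((π.expect ^ 1) h s₀ - (π.expect ^ (T + 1)) h s₀) := fun T => by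
    induction T with
    | zero => simp
    | succ T ih =>
      rw [Finset.sum_Icc_succ_top (by omega), ih, map_sub, map_add, hconst, Pi.sub_apply,
        Pi.add_apply, pow_succ π.expect (T + 1), Module.End.mul_apply]
      push_cast
      ring
  have h0 : Tendsto (fun T : ℕ => (T : ℝ)⁻¹ *
      ((π.expect ^ 1) h s₀ - (π.expect ^ (T + 1)) h s₀)) atTop (𝓝 0) := by
    refine squeeze_zero_norm (a := fun T : ℕ => (T : ℝ)⁻¹ * (‖h‖ + ‖h‖)) (fun T => ?_)
      (by simpa using (tendsto_inv_atTop_nhds_zero_nat (𝕜 := ℝ)).mul_const (‖h‖ + ‖h‖))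
    rw [norm_mul, Real.norm_of_nonneg (by positivity)]
    exact mul_le_mul_of_nonneg_left
      ((norm_sub_le _ _).trans (add_le_add (hbd 1) (hbd (T + 1)))) (by positivity)
  have h1 := (tendsto_const_nhds (x := C)).add h0
  rw [add_zero] at h1
  refine h1.congr' ?_
  filter_upwards [eventually_ne_atTop 0] with T hT
  have hT' : (T : ℝ) ≠ 0 := by exact_mod_cast hT
  rw [hsum, mul_add, inv_mul_cancel_left₀ hT']

lemma Policy.sum_prob_mul_bellmanRHS (π : P.Policy) (h : P.State → ℝ) (s : P.State) :
    ∑ a, π.prob s a * P.bellmanRHS h s a = π.expCost s + π.expect h s := by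
  simp only [bellmanRHS, mul_add, Finset.sum_add_distrib, Policy.expCost, Policy.expect_apply]

/-- No policy has an average cost below the gain of a solution of the Bellman equation. -/
lemma Bellman.le_averageCost {C : ℝ} {h : P.State → ℝ} (hB : P.Bellman C h) {π : P.Policy}
    {s₀ : P.State} {c : ℝ} (hc : P.HasAverageCost π s₀ c) : C ≤ c := by
  refine le_of_tendsto_of_tendsto' (tendsto_average_telescope π s₀ C h)
    ((hasAverageCost_iff π s₀ c).1 hc) fun T => ?_
  refine mul_le_mul_of_nonneg_left (Finset.sum_le_sum fun t _ => ?_) (by positivity)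
  refine π.expect_pow_mono t (fun s => ?_) s₀
  -- Averaging the Bellman inequality over the actions of `π` bounds C + h - E h by the one-step
  -- cost pointwise; powers of E preserve this.
  have h1 : C + h s ≤ ∑ a, π.prob s a * P.bellmanRHS h s a := by
    calc C + h s = ∑ a, π.prob s a * (C + h s) := by rw [← Finset.sum_mul, π.sum_prob, one_mul]
      _ ≤ _ := Finset.sum_le_sum fun a _ =>
        mul_le_mul_of_nonneg_left ((hB s).2 ⟨a, rfl⟩) (π.prob_nonneg s a)
  rw [π.sum_prob_mul_bellmanRHS] at h1
  simp only [Pi.sub_apply, Pi.add_apply]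
  linarith

/-- A deterministic policy choosing minimizing actions attains the gain. -/
lemma Bellman.hasAverageCost_ofDet {C : ℝ} {h : P.State → ℝ} (hB : P.Bellman C h)
    {f : P.State → P.Action} (hf : ∀ s a, P.bellmanRHS h s (f s) ≤ P.bellmanRHS h s a)
    (s₀ : P.State) : P.HasAverageCost (Policy.ofDet f) s₀ C := by
  rw [hasAverageCost_iff]
  have hcost : (Policy.ofDet f).expCost = (fun _ => C) + h - (Policy.ofDet f).expect h := by
    ext s
    have h1 := (Policy.ofDet f).sum_prob_mul_bellmanRHS h s
    have h2 : ∑ a, (Policy.ofDet f).prob s a * P.bellmanRHS h s a = P.bellmanRHS h s (f s) := by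
      simp [Policy.ofDet]
    obtain ⟨a, ha⟩ := (hB s).1
    have h3 : P.bellmanRHS h s (f s) = C + h s :=
      le_antisymm (ha ▸ hf s a) ((hB s).2 ⟨f s, rfl⟩)
    simp only [Pi.sub_apply, Pi.add_apply]
    linarith
  rw [hcost]
  exact tendsto_average_telescope _ s₀ C h

end Network

end

/-- The average cost of every policy exists. There is a constant `Cstar` which, from every initial
state, is the minimum average cost, and it satisfies the Bellman equation with some `h`. For every
such `h`, every deterministic policy choosing minimizing actions attains `Cstar` from every initial
state. -/
theorem proposition2 (P : Network) :
    (∀ (π : P.Policy) (s₀ : P.State), ∃ c : ℝ, P.HasAverageCost π s₀ c) ∧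
    ∃ Cstar : ℝ,
      (∀ s₀ : P.State, IsLeast {c : ℝ | ∃ π : P.Policy, P.HasAverageCost π s₀ c} Cstar) ∧
      (∃ h : P.State → ℝ, P.Bellman Cstar h) ∧
      (∀ h : P.State → ℝ, P.Bellman Cstar h →
        ∀ f : P.State → P.Action,
          (∀ s a, P.bellmanRHS h s (f s) ≤ P.bellmanRHS h s a) →
          ∀ s₀ : P.State, P.HasAverageCost (Network.Policy.ofDet f) s₀ Cstar) := by
  obtain ⟨C, h₀, hB₀⟩ := P.exists_bellman
  refine ⟨Network.exists_hasAverageCost, C, fun s₀ => ⟨?_, ?_⟩, ⟨h₀, hB₀⟩,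
    fun h hB f hf s₀ => hB.hasAverageCost_ofDet hf s₀⟩
  · choose f hf using fun s => (hB₀ s).1
    exact ⟨Network.Policy.ofDet f,
      hB₀.hasAverageCost_ofDet (fun s a => (hf s).le.trans ((hB₀ s).2 ⟨a, rfl⟩)) s₀⟩
  · rintro c ⟨π, hc⟩
    exact hB₀.le_averageCost hc
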